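/- Let $K$ be an algebraically closed field, let $d\ge 2$, and let $G=\langle\sigma\rangle\subseteq \mathrm{GL}(K^d)$ be a finite cyclic group whose order is not divisible by the characteristic of $K$. Let $b_1,\dots,b_d$ be a basis of $K^d$, $n_1\ge 1$ an integer, $\xi_1\in K$ a primitive $n_1$-th root of unity and $t_{11},\dots,t_{1d}$ non-negative integers such that $\sigma(b_j)=\xi_1^{t_{1j}}b_j$ for $1\le j\le d$ and $\gcd(t_{11},\dots,t_{1d},n_1)=1$. Let $R=K[X_1,\dots,X_d]$ with the standard grading $\deg X_j=1$, on which $G$ acts by $K$-algebra automorphisms through the identification of $X_j$ with $b_j$: if $g(b_j)=\sum_i a_{ij}b_i$, then $g(X_j)=\sum_i a_{ij}X_i$ (in particular $\sigma(X_j)=\xi_1^{t_{1j}}X_j$). Let $R^G$ be the graded ring of invariants, $\mathfrak m_G$ its graded maximal ideal (generated by the homogeneous invariants of positive degree), and ${}^*\operatorname{Spec}R^G$ the set of graded prime ideals of $R^G$. For a character $\mathcal X$, i.e. a group homomorphism $\mathcal X\colon G\to \mathrm{GL}(K)=K^\times$, let $$R^{\mathcal X}=\{a\in R \mid g(a)=\mathcal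 X(g)a\ \text{for all } g\in G\},$$ an $R^G$-module. Suppose that $G$ has no pseudo-reflection, i.e. no element of $G$ of finite order has an eigenspace for the eigenvalue $1$ of dimension $d-1$. Then the following are equivalent. 1. For each character $\mathcal X$ of $G$, $R^{\mathcal X}$ is locally free on ${}^*\operatorname{Spec}R^G\setminus\{\mathfrak m_G\}$, i.e. the localization $R^{\mathcal X}_{\mathfrak p}$ is a free $R^G_{\mathfrak p}$-module for every graded prime ideal $\mathfrak p\ne\mathfrak m_G$ of $R^G$. 2. $\gcd(t_{1j},n_1)=1$ for all $1\le j\le d$. -/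

import Mathlib

open MvPolynomial

noncomputable section

namespace SemiInv

variable {K : Type*} [Field K] {d : ℕ}

/-- The `K`-algebra endomorphism of `R = K[X_1, …, X_d]` induced by `g ∈ GL(K^d)`. The variable `X_j`
is identified with the basis vector `b_j`: if `g b_j = ∑ i, a_{ij} b_i`, then
`X_j ↦ ∑ i, a_{ij} X_i`. -/
def act (b : Module.Basis (Fin d) K (Fin d → K))
    (g : LinearMap.GeneralLinearGroup K (Fin d → K)) :
    MvPolynomial (Fin d) K →ₐ[K] MvPolynomial (Fin d) K :=
  aeval fun j => ∑ i, C (b.repr ((g : (Fin d → K) →ₗ[K] (Fin d → K)) (b j)) i) * X i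

/-- The ring of invariants `R^G`. -/
def invariants (b : Module.Basis (Fin d) K (Fin d → K))
    (G : Subgroup (LinearMap.GeneralLinearGroup K (Fin d → K))) :
    Subalgebra K (MvPolynomial (Fin d) K) where
  carrier := {f | ∀ g ∈ G, act b g f = f}
  mul_mem' hf hf' g hg := by rw [map_mul, hf g hg, hf' g hg]
  add_mem' hf hf' g hg := by rw [map_add, hf g hg, hf' g hg]
  algebraMap_mem' r g _ := (act b g).commutes r

/-- The semi-invariants `R^χ` of weight `χ`, an `R^G`-submodule of `R`. -/
def semiInvariants (b : Module.Basis (Fin d) K (Fin d → K))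
    (G : Subgroup (LinearMap.GeneralLinearGroup K (Fin d → K))) (χ : G →* Kˣ) :
    Submodule (invariants b G) (MvPolynomial (Fin d) K) where
  carrier := {f | ∀ g : G, act b (g : LinearMap.GeneralLinearGroup K (Fin d → K)) f =
    C ((χ g : Kˣ) : K) * f}
  zero_mem' g := by rw [map_zero, mul_zero]
  add_mem' hf hf' g := by rw [map_add, hf g, hf' g, mul_add]
  smul_mem' a f hf g := by
    rw [Subalgebra.smul_def, smul_eq_mul, map_mul, hf g, a.2 g g.2, mul_left_comm]

/-- The `R^G`-module structure of `R^χ`, recorded to shorten instance search. -/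
instance semiInvariantsModule (b : Module.Basis (Fin d) K (Fin d → K))
    (G : Subgroup (LinearMap.GeneralLinearGroup K (Fin d → K))) (χ : G →* Kˣ) :
    Module (invariants b G) (semiInvariants b G χ) :=
  (semiInvariants b G χ).module

/-- The elements of `R^G` that are homogeneous of degree `m` (with `deg X_j = 1`). -/
def grading (b : Module.Basis (Fin d) K (Fin d → K))
    (G : Subgroup (LinearMap.GeneralLinearGroup K (Fin d → K))) (m : ℕ) :
    Submodule K (invariants b G) :=
  (homogeneousSubmodule (Fin d) K m).comap (invariants b G).val.toLinearMap

theorem mem_grading (b : Module.Basis (Fin d) K (Fin d → K))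
    (G : Subgroup (LinearMap.GeneralLinearGroup K (Fin d → K))) (m : ℕ) (f : invariants b G) :
    f ∈ grading b G m ↔ (f : MvPolynomial (Fin d) K).IsHomogeneous m := Iff.rfl

theorem act_isHomogeneous (b : Module.Basis (Fin d) K (Fin d → K))
    (g : LinearMap.GeneralLinearGroup K (Fin d → K)) {f : MvPolynomial (Fin d) K} {m : ℕ}
    (hf : f.IsHomogeneous m) : (act b g f).IsHomogeneous m := by
  have h := hf.aeval (fun j => ∑ i,
    C (b.repr ((g : (Fin d → K) →ₗ[K] (Fin d → K)) (b j)) i) * X i) (n := 1)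
    (fun j => IsHomogeneous.sum _ _ _ fun i _ => isHomogeneous_C_mul_X _ i)
  rwa [one_mul] at h

theorem homogeneousComponent_act (b : Module.Basis (Fin d) K (Fin d → K))
    (g : LinearMap.GeneralLinearGroup K (Fin d → K)) (f : MvPolynomial (Fin d) K) (m : ℕ) :
    homogeneousComponent m (act b g f) = act b g (homogeneousComponent m f) := by
  conv_lhs => rw [← sum_homogeneousComponent f, map_sum, map_sum]
  simp_rw [homogeneousComponent_of_mem
    (act_isHomogeneous b g (homogeneousComponent_isHomogeneous _ f))]
  rw [Finset.sum_ite_eq]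
  split_ifs with h
  · rfl
  · rw [homogeneousComponent_eq_zero _ _ (by simpa [Nat.lt_succ_iff] using h), map_zero]

theorem homogeneousComponent_mem_invariants (b : Module.Basis (Fin d) K (Fin d → K))
    (G : Subgroup (LinearMap.GeneralLinearGroup K (Fin d → K))) (f : invariants b G) (m : ℕ) :
    homogeneousComponent m (f : MvPolynomial (Fin d) K) ∈ invariants b G := fun g hg => by
  rw [← homogeneousComponent_act, f.2 g hg]

/-- The homogeneous decomposition of an invariant polynomial. -/
def decomposeFun (b : Module.Basis (Fin d) K (Fin d → K))
    (G : Subgroup (LinearMap.GeneralLinearGroup K (Fin d → K))) (f : invariants b G) :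
    DirectSum ℕ fun m => grading b G m :=
  DirectSum.mk (fun m => grading b G m)
    (Finset.range ((f : MvPolynomial (Fin d) K).totalDegree + 1))
    fun m => ⟨⟨homogeneousComponent m (f : MvPolynomial (Fin d) K),
      homogeneousComponent_mem_invariants b G f m⟩, homogeneousComponent_isHomogeneous _ _⟩

theorem decomposeFun_apply (b : Module.Basis (Fin d) K (Fin d → K))
    (G : Subgroup (LinearMap.GeneralLinearGroup K (Fin d → K))) (f : invariants b G) (m : ℕ) :
    ((decomposeFun b G f m : invariants b G) : MvPolynomial (Fin d) K) =
      homogeneousComponent m (f : MvPolynomial (Fin d) K) := by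
  rw [decomposeFun]
  by_cases hm : m ∈ Finset.range ((f : MvPolynomial (Fin d) K).totalDegree + 1)
  · rw [DirectSum.mk_apply_of_mem hm]
  · rw [DirectSum.mk_apply_of_notMem hm,
      homogeneousComponent_eq_zero _ _ (by simpa [Nat.lt_succ_iff] using hm)]
    rfl

theorem homogeneousComponent_coe (b : Module.Basis (Fin d) K (Fin d → K))
    (G : Subgroup (LinearMap.GeneralLinearGroup K (Fin d → K)))
    (x : DirectSum ℕ fun m => grading b G m) (m : ℕ) :
    homogeneousComponent m ((DirectSum.coeAddMonoidHom (grading b G) x : invariants b G) :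
      MvPolynomial (Fin d) K) = ((x m : invariants b G) : MvPolynomial (Fin d) K) := by
  induction x using DirectSum.induction_on with
  | zero => simp
  | of i x =>
    rw [DirectSum.coeAddMonoidHom_of, homogeneousComponent_of_mem
      ((mem_grading b G i x).1 x.2), DirectSum.coe_of_apply]
    split_ifs <;> first | rfl | omega
  | add x y hx hy => simp [hx, hy]

theorem sum_homogeneousComponent_le (p : MvPolynomial (Fin d) K) (N : ℕ) (hp : p.totalDegree ≤ N) :
    ∑ i ∈ Finset.range (N + 1), homogeneousComponent i p = p := by
  conv_rhs => rw [← sum_homogeneousComponent p]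
  symm
  apply Finset.sum_subset (Finset.range_mono (by omega))
  intro i _ hi
  exact homogeneousComponent_eq_zero _ _ (by simpa [Nat.lt_succ_iff] using hi)

theorem eq_of_homogeneousComponent_eq {p q : MvPolynomial (Fin d) K}
    (h : ∀ m, homogeneousComponent m p = homogeneousComponent m q) : p = q := by
  have hp := sum_homogeneousComponent_le p (max p.totalDegree q.totalDegree) (le_max_left _ _)
  have hq := sum_homogeneousComponent_le q (max p.totalDegree q.totalDegree) (le_max_right _ _)
  exact hp.symm.trans ((Finset.sum_congr rfl fun i _ => h i).trans hq)

instance gradedMonoid (b : Module.Basis (Fin d) K (Fin d → K))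
    (G : Subgroup (LinearMap.GeneralLinearGroup K (Fin d → K))) :
    SetLike.GradedMonoid (grading b G) where
  one_mem := isHomogeneous_one _ _
  mul_mem i j f g hf hg := by
    rw [mem_grading] at hf hg ⊢
    rw [Subalgebra.coe_mul]
    exact hf.mul hg

instance decomposition (b : Module.Basis (Fin d) K (Fin d → K))
    (G : Subgroup (LinearMap.GeneralLinearGroup K (Fin d → K))) :
    DirectSum.Decomposition (grading b G) where
  decompose' := decomposeFun b G
  left_inv f := by
    apply Subtype.ext
    apply eq_of_homogeneousComponent_eq
    intro m
    rw [homogeneousComponent_coe, decomposeFun_apply]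
  right_inv x := by
    ext m : 1
    apply Subtype.ext
    apply Subtype.ext
    rw [decomposeFun_apply, homogeneousComponent_coe]

instance gradedAlgebra (b : Module.Basis (Fin d) K (Fin d → K))
    (G : Subgroup (LinearMap.GeneralLinearGroup K (Fin d → K))) :
    GradedAlgebra (grading b G) where
  toGradedMonoid := gradedMonoid b G
  toDecomposition := decomposition b G

/-- The graded maximal ideal `𝔪_G` of `R^G`, generated by the homogeneous invariants of
positive degree. -/
def gradedMaximalIdeal (b : Module.Basis (Fin d) K (Fin d → K))
    (G : Subgroup (LinearMap.GeneralLinearGroup K (Fin d → K))) : Ideal (invariants b G) :=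
  (HomogeneousIdeal.irrelevant (grading b G)).toIdeal

/-- The graded punctured spectrum `*Spec R^G ∖ {𝔪_G}`: the graded prime ideals of `R^G` other
than `𝔪_G`. -/
def gradedPuncturedSpectrum (b : Module.Basis (Fin d) K (Fin d → K))
    (G : Subgroup (LinearMap.GeneralLinearGroup K (Fin d → K))) :
    Set (PrimeSpectrum (invariants b G)) :=
  {p | p.asIdeal.IsHomogeneous (grading b G) ∧ p.asIdeal ≠ gradedMaximalIdeal b G}

/-- `M` is locally free on `V ⊆ Spec A`: `M_𝔭` is a free `A_𝔭`-module for all `𝔭 ∈ V`. -/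
def IsLocallyFreeOn (A : Type*) [CommRing A] (M : Type*) [AddCommGroup M] [Module A M]
    (V : Set (PrimeSpectrum A)) : Prop :=
  ∀ p ∈ V, Module.Free (Localization.AtPrime p.asIdeal)
    (LocalizedModule p.asIdeal.primeCompl M)

/-- `g ∈ GL(K^d)` is a pseudo-reflection: it has finite order, and its eigenspace for the
eigenvalue `1` has dimension `d - 1`. -/
def IsPseudoReflection (g : LinearMap.GeneralLinearGroup K (Fin d → K)) : Prop :=
  IsOfFinOrder g ∧
    Module.finrank K (Module.End.eigenspace (g : (Fin d → K) →ₗ[K] (Fin d → K)) 1) + 1 = d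

end SemiInv

end

/-! Every element of `G` is diagonal in the basis `b`, so each monomial is an eigenvector of `σ`,
and a weight is determined by its value on `σ`, a power of `ξ`.

Suppose every `t j` is a unit modulo `n`. A prime `p ≠ 𝔪_G` omits some `X j ^ n`, because the `n`-th
power of a nonconstant invariant monomial is a multiple in `R^G` of some `X j ^ n`. Some power `X j
^ k` has weight `χ`, and once `X j ^ n` is inverted it generates `R^χ` freely.

Conversely, take `χ σ = ξ` and localize at the prime of invariants vanishing on the `j`-th axis.
Without pseudo-reflections, Bézout gives for each `i` a monomial `M i` of weight `ξ` not involving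
`X i` (`gcd_erase_eq_one`). Freeness in rank at most one gives a semi-invariant `f`, and an
invariant `s` nonzero on the axis, with every `s * M i` in `R^G f`. The `M i` have no common prime
factor, so `f ∣ s` by factoriality, and `f` is nonzero on the axis
(`exists_axisRestriction_ne_zero`). With `e = gcd (t j, n)`, the power `σ ^ (n / e)` fixes `X j` but
scales `f` by `ξ ^ (n / e)`; hence `e = 1`. -/

noncomputable section

namespace SemiInv

/-! ### Freeness of localizations in rank at most one -/

section LocalFreeness

variable {A M : Type*} [CommRing A] [IsDomain A] [AddCommGroup M] [Module A M]

/-- A module whose elements are, up to one denominator outside `p`, multiples of a torsion-free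
element is free at `p`. -/
theorem free_localizedModule_of_smul_eq (p : Ideal A) [p.IsPrime] (m₀ : M)
    (hm₀ : ∀ a : A, a • m₀ = 0 → a = 0) (s : A) (hs : s ∉ p)
    (h : ∀ m : M, ∃ a : A, s • m = a • m₀) :
    Module.Free (Localization.AtPrime p) (LocalizedModule p.primeCompl M) := by
  refine Module.Free.of_equiv (LinearEquiv.ofBijective (LinearMap.toSpanSingleton
    (Localization.AtPrime p) (LocalizedModule p.primeCompl M) (LocalizedModule.mk m₀ 1)) ⟨?_, ?_⟩)
  · rw [← LinearMap.ker_eq_bot, LinearMap.ker_eq_bot']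
    intro c hc
    induction c using Localization.induction_on with
    | H x =>
      obtain ⟨a, t⟩ := x
      rw [LinearMap.toSpanSingleton_apply, LocalizedModule.mk_smul_mk,
        ← LocalizedModule.zero_mk 1, LocalizedModule.mk_eq] at hc
      obtain ⟨u, hu⟩ := hc
      have hu' : ((u : A) * a) • m₀ = 0 := by
        simpa [Submonoid.smul_def, mul_smul] using hu
      rcases mul_eq_zero.1 (hm₀ _ hu') with h0 | h0
      · exact absurd (h0 ▸ p.zero_mem) u.2
      · rw [h0, Localization.mk_zero]
  · intro y
    induction y using LocalizedModule.induction_on with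
    | h m t =>
      obtain ⟨a, ha⟩ := h m
      refine ⟨Localization.mk a (⟨s, hs⟩ * t), ?_⟩
      rw [LinearMap.toSpanSingleton_apply, LocalizedModule.mk_smul_mk, LocalizedModule.mk_eq]
      refine ⟨1, ?_⟩
      simp only [one_smul, mul_one, ← ha, Submonoid.smul_def, Submonoid.coe_mul]
      rw [← mul_smul, mul_comm]

/-- If a module of rank at most one is free at `p`, then finitely many elements are, up to a common
denominator outside `p`, multiples of a single element. -/
theorem exists_smul_eq_smul_of_free {ι : Type*} [Fintype ι] (p : Ideal A) [p.IsPrime]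
    (hfree : Module.Free (Localization.AtPrime p) (LocalizedModule p.primeCompl M))
    (hrank : ∀ x y : M, x ≠ 0 → ∃ a c : A, c ≠ 0 ∧ a • x = c • y) (m : ι → M) :
    ∃ f : M, ∃ s : A, s ∉ p ∧ ∀ i, ∃ a : A, s • m i = a • f := by
  classical
  let B := Module.Free.chooseBasis (Localization.AtPrime p) (LocalizedModule p.primeCompl M)
  have hsub : Subsingleton (Module.Free.ChooseBasisIndex (Localization.AtPrime p)
      (LocalizedModule p.primeCompl M)) := by
    -- Two distinct basis vectors `x / sx` and `y / sy` would satisfy a relation with coefficient `c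
    -- * sy ≠ 0`, obtained from `a • x = c • y`.
    refine ⟨fun k l => ?_⟩
    by_contra hkl
    obtain ⟨⟨x, sx⟩, hx⟩ : ∃ z : M × p.primeCompl, LocalizedModule.mk z.1 z.2 = B k := by
      induction B k using LocalizedModule.induction_on with
      | h m t => exact ⟨(m, t), rfl⟩
    obtain ⟨⟨y, sy⟩, hy⟩ : ∃ z : M × p.primeCompl, LocalizedModule.mk z.1 z.2 = B l := by
      induction B l using LocalizedModule.induction_on with
      | h m t => exact ⟨(m, t), rfl⟩
    have hx0 : x ≠ 0 := by
      rintro rfl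
      exact B.ne_zero k (by rw [← hx, LocalizedModule.zero_mk])
    obtain ⟨a, c, hc, hac⟩ := hrank x y hx0
    have hrel : Localization.mk (a * sx) (1 : p.primeCompl) • B k =
        Localization.mk (c * sy) (1 : p.primeCompl) • B l := by
      rw [← hx, ← hy, LocalizedModule.mk_smul_mk, LocalizedModule.mk_smul_mk,
        LocalizedModule.mk_eq]
      refine ⟨1, ?_⟩
      simp only [one_smul, one_mul, Submonoid.smul_def, ← mul_smul]
      rw [mul_comm a, mul_comm c, ← mul_assoc, ← mul_assoc, mul_smul, hac, mul_smul _ c,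
        mul_comm (sx : A)]
    have h0 := congrArg (fun v => B.repr v l) hrel
    simp only [map_smul, Module.Basis.repr_self, Finsupp.smul_apply, smul_eq_mul,
      Finsupp.single_eq_same, Finsupp.single_eq_of_ne (Ne.symm hkl), mul_zero, mul_one] at h0
    rw [← Localization.mk_zero 1, Localization.mk_eq_mk_iff, Localization.r_iff_exists] at h0
    obtain ⟨u, hu⟩ := h0
    simp only [Submonoid.coe_one, one_mul, mul_zero] at hu
    rcases mul_eq_zero.1 hu.symm with h1 | h1
    · exact absurd (h1 ▸ p.zero_mem) u.2
    · rcases mul_eq_zero.1 h1 with h2 | h2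
      · exact hc h2
      · exact absurd (h2 ▸ p.zero_mem) sy.2
  obtain ⟨e, he⟩ : ∃ e : LocalizedModule p.primeCompl M, ∀ v, ∃ c : Localization.AtPrime p,
      v = c • e := by
    rcases isEmpty_or_nonempty (Module.Free.ChooseBasisIndex (Localization.AtPrime p)
      (LocalizedModule p.primeCompl M)) with h | ⟨⟨k⟩⟩
    -- Rank zero: the localization vanishes, so `0` generates it.
    · refine ⟨0, fun v => ⟨0, ?_⟩⟩
      rw [smul_zero]
      exact B.repr.injective (Subsingleton.elim _ _)
    · refine ⟨B k, fun v => ⟨B.repr v k, B.repr.injective ?_⟩⟩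
      ext l
      rw [Subsingleton.elim l k]
      simp
  induction e using LocalizedModule.induction_on with
  | h f t =>
    have key : ∀ i, ∃ s : A, s ∉ p ∧ ∃ a : A, s • m i = a • f := by
      intro i
      obtain ⟨c, hc⟩ := he (LocalizedModule.mk (m i) 1)
      induction c using Localization.induction_on with
      | H x =>
        obtain ⟨a, r⟩ := x
        rw [LocalizedModule.mk_smul_mk, LocalizedModule.mk_eq] at hc
        obtain ⟨u, hu⟩ := hc
        refine ⟨u * (r * t), (u * (r * t)).2, u * a, ?_⟩
        simpa [Submonoid.smul_def, mul_smul] using hu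
    choose s hs a ha using key
    refine ⟨f, ∏ i, s i, ?_, fun i => ⟨(∏ k ∈ Finset.univ.erase i, s k) * a i, ?_⟩⟩
    · rw [Ideal.IsPrime.prod_mem_iff]
      rintro ⟨i, -, hi⟩
      exact hs i hi
    · rw [← Finset.mul_prod_erase _ _ (Finset.mem_univ i), mul_comm, mul_smul, ha, mul_smul]

end LocalFreeness

/-- In a factorial domain, a divisor of all `s * m i` divides `s` if no prime divides
all `m i`. -/
theorem dvd_of_forall_dvd_mul {R ι : Type*} [CommRing R] [IsDomain R]
    [UniqueFactorizationMonoid R] (m : ι → R) (hm : ∀ q, Prime q → ∃ i, ¬ q ∣ m i)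
    (i₀ : ι) (h₀ : m i₀ ≠ 0) (f : R) : ∀ s, (∀ i, f ∣ s * m i) → f ∣ s := by
  induction f using UniqueFactorizationMonoid.induction_on_prime with
  | h₁ =>
    intro s h
    have := zero_dvd_iff.1 (h i₀)
    exact zero_dvd_iff.2 ((mul_eq_zero.1 this).resolve_right h₀)
  | h₂ x hx => exact fun s _ => hx.dvd
  | h₃ f q hf hq ih =>
    intro s h
    obtain ⟨i, hi⟩ := hm q hq
    -- The prime `q` divides `s * m i` but not `m i`, so it can be split off from `s` and cancelled.
    obtain ⟨r, rfl⟩ := (hq.dvd_or_dvd ((dvd_mul_right q f).trans (h i))).resolve_right hi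
    refine mul_dvd_mul_left q (ih r fun k => ?_)
    have := h k
    rw [mul_assoc] at this
    exact (mul_dvd_mul_iff_left hq.ne_zero).1 this

/-! ### Bézout coefficients and the diagonal action -/

section

theorem exists_sum_mul_eq_gcd {ι : Type*} (R : Type*) [CommRing R] (S : Finset ι)
    (t : ι → ℕ) : ∃ a : ι → R, ∑ l ∈ S, a l * (t l : R) = (S.gcd t : ℕ) := by
  classical
  induction S using Finset.induction_on with
  | empty => exact ⟨0, by simp⟩
  | insert i S hi ih =>
    obtain ⟨a, ha⟩ := ih
    refine ⟨fun l => if l = i then (Nat.gcdA (t i) (S.gcd t) : R)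
      else (Nat.gcdB (t i) (S.gcd t) : R) * a l, ?_⟩
    have h := congrArg (Int.cast : ℤ → R) (Nat.gcd_eq_gcd_ab (t i) (S.gcd t))
    push_cast at h
    rw [Finset.sum_insert hi]
    beta_reduce
    rw [if_pos rfl, Finset.gcd_insert, gcd_eq_nat_gcd, h,
      mul_comm (t i : R), ← ha, Finset.sum_mul]
    congr 1
    refine Finset.sum_congr rfl fun l hl => ?_
    rw [if_neg (ne_of_mem_of_not_mem hl hi)]
    ring

/-- Bézout's identity modulo `n` with natural coefficients. -/
theorem exists_sum_mul_modEq_one {ι : Type*} (S : Finset ι) (t : ι → ℕ) {n : ℕ} (hn : 0 < n)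
    (h : Nat.gcd (S.gcd t) n = 1) : ∃ a : ι → ℕ, ∑ l ∈ S, a l * t l ≡ 1 [MOD n] := by
  have : NeZero n := ⟨hn.ne'⟩
  obtain ⟨a, ha⟩ := exists_sum_mul_eq_gcd (ZMod n) S t
  -- The gcd is a unit modulo `n`; dividing the Bézout coefficients by it in `ZMod n` and taking
  -- representatives makes them natural.
  refine ⟨fun l => ((((S.gcd t : ℕ) : ZMod n))⁻¹ * a l).val, ?_⟩
  rw [← ZMod.natCast_eq_natCast_iff]
  push_cast
  simp_rw [ZMod.natCast_val, ZMod.cast_id', id, mul_assoc, ← Finset.mul_sum, ha]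
  rw [mul_comm, ZMod.coe_mul_inv_eq_one _ h]

variable {K : Type*} [Field K] {d : ℕ}

theorem act_X_of_apply_eq_smul (b : Module.Basis (Fin d) K (Fin d → K))
    (g : LinearMap.GeneralLinearGroup K (Fin d → K)) (j : Fin d) (c : K)
    (h : (g : (Fin d → K) →ₗ[K] (Fin d → K)) (b j) = c • b j) :
    act b g (X j) = C c * X j := by
  rw [act, aeval_X, h, Finset.sum_eq_single j]
  · simp
  · intro i _ hij
    simp [Finsupp.single_eq_of_ne hij]
  · simp

theorem pow_apply_eq_smul (σ : LinearMap.GeneralLinearGroup K (Fin d → K)) (v : Fin d → K) (c : K)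
    (h : (σ : (Fin d → K) →ₗ[K] (Fin d → K)) v = c • v) (k : ℕ) :
    ((σ ^ k : LinearMap.GeneralLinearGroup K (Fin d → K)) : (Fin d → K) →ₗ[K] (Fin d → K)) v =
      c ^ k • v := by
  induction k with
  | zero => simp
  | succ k ih =>
    rw [pow_succ, Units.val_mul, Module.End.mul_apply, h, map_smul, ih, smul_smul, pow_succ,
      mul_comm]

section Diagonal

variable {b : Module.Basis (Fin d) K (Fin d → K)}
  {σ : LinearMap.GeneralLinearGroup K (Fin d → K)} {c : Fin d → K}

theorem act_pow_X (hσ : ∀ j, (σ : (Fin d → K) →ₗ[K] (Fin d → K)) (b j) = c j • b j) (k : ℕ)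
    (j : Fin d) : act b (σ ^ k) (X j) = C (c j ^ k) * X j :=
  act_X_of_apply_eq_smul b _ j _ (pow_apply_eq_smul σ _ _ (hσ j) k)

theorem act_pow_eigen (hσ : ∀ j, (σ : (Fin d → K) →ₗ[K] (Fin d → K)) (b j) = c j • b j)
    {f : MvPolynomial (Fin d) K} {w : K} (hf : act b σ f = C w * f) (k : ℕ) :
    act b (σ ^ k) f = C (w ^ k) * f := by
  induction k with
  | zero =>
    have : act b (σ ^ 0) = AlgHom.id K _ := by
      ext1 j
      simpa using act_pow_X hσ 0 j
    rw [this, pow_zero, map_one, one_mul, AlgHom.id_apply]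
  | succ k ih =>
    have : act b (σ ^ (k + 1)) = (act b (σ ^ k)).comp (act b σ) := by
      ext1 j
      have h1 := act_pow_X hσ 1 j
      rw [pow_one, pow_one] at h1
      rw [AlgHom.comp_apply, h1, map_mul, algHom_C, algebraMap_eq, act_pow_X hσ, act_pow_X hσ,
        pow_succ, map_mul]
      ring
    rw [this, AlgHom.comp_apply, hf, map_mul, algHom_C, algebraMap_eq, ih, pow_succ, map_mul]
    ring

theorem act_monomial (hσ : ∀ j, (σ : (Fin d → K) →ₗ[K] (Fin d → K)) (b j) = c j • b j)
    (m : Fin d →₀ ℕ) (a : K) :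
    act b σ (monomial m a) = C (∏ j, c j ^ m j) * monomial m a := by
  have hX : ∀ j, act b σ (X j) = C (c j) * X j := fun j => act_X_of_apply_eq_smul b σ j _ (hσ j)
  rw [monomial_eq, Finsupp.prod_fintype _ _ (fun _ => pow_zero _), map_mul, algHom_C,
    algebraMap_eq, map_prod]
  simp_rw [map_pow, hX, mul_pow, Finset.prod_mul_distrib, map_prod, map_pow]
  ring

theorem coeff_act (hσ : ∀ j, (σ : (Fin d → K) →ₗ[K] (Fin d → K)) (b j) = c j • b j)
    (f : MvPolynomial (Fin d) K) (m : Fin d →₀ ℕ) :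
    coeff m (act b σ f) = (∏ j, c j ^ m j) * coeff m f := by
  induction f using MvPolynomial.induction_on' with
  | monomial u a =>
    rw [act_monomial hσ, coeff_C_mul, coeff_monomial]
    split_ifs with h
    · rw [h]
    · simp
  | add p q hp hq => rw [map_add, coeff_add, coeff_add, hp, hq, mul_add]

theorem exists_nat_pow_eq {Γ : Type*} [Group Γ] {G : Subgroup Γ} [Finite G] {σ : Γ}
    (hG : G = Subgroup.zpowers σ) {g : Γ} (hg : g ∈ G) : ∃ k : ℕ, g = σ ^ k := by
  have hf : IsOfFinOrder σ := by
    have := isOfFinOrder_of_finite (⟨σ, hG ▸ Subgroup.mem_zpowers σ⟩ : G)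
    exact (Submonoid.isOfFinOrder_coe (H := G.toSubmonoid)).2 this
  rw [hG, ← hf.mem_powers_iff_mem_zpowers] at hg
  obtain ⟨k, hk⟩ := hg
  exact ⟨k, hk.symm⟩

variable {G : Subgroup (LinearMap.GeneralLinearGroup K (Fin d → K))} [Finite G]

theorem mem_semiInvariants_iff (hG : G = Subgroup.zpowers σ)
    (hσ : ∀ j, (σ : (Fin d → K) →ₗ[K] (Fin d → K)) (b j) = c j • b j) (χ : G →* Kˣ)
    (f : MvPolynomial (Fin d) K) :
    f ∈ semiInvariants b G χ ↔
      act b σ f = C ((χ ⟨σ, hG ▸ Subgroup.mem_zpowers σ⟩ : Kˣ) : K) * f := by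
  refine ⟨fun h => h ⟨σ, hG ▸ Subgroup.mem_zpowers σ⟩, fun h g => ?_⟩
  obtain ⟨k, hk⟩ := exists_nat_pow_eq hG g.2
  have hg : g = (⟨σ, hG ▸ Subgroup.mem_zpowers σ⟩ : G) ^ k := Subtype.ext hk
  rw [hk, act_pow_eigen hσ h k, hg, map_pow χ, Units.val_pow_eq_pow_val]

theorem mem_invariants_iff (hG : G = Subgroup.zpowers σ)
    (hσ : ∀ j, (σ : (Fin d → K) →ₗ[K] (Fin d → K)) (b j) = c j • b j)
    (f : MvPolynomial (Fin d) K) : f ∈ invariants b G ↔ act b σ f = f := by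
  refine ⟨fun h => h _ (hG ▸ Subgroup.mem_zpowers σ), fun h g hg => ?_⟩
  obtain ⟨k, rfl⟩ := exists_nat_pow_eq hG hg
  rw [act_pow_eigen hσ (w := 1) (by rw [h, map_one, one_mul]) k, one_pow, map_one, one_mul]

end Diagonal

/-- The fixed space is the hyperplane where the `i`-th coordinate vanishes. -/
theorem isPseudoReflection_of_apply_eq (b : Module.Basis (Fin d) K (Fin d → K))
    (g : LinearMap.GeneralLinearGroup K (Fin d → K)) (hg : IsOfFinOrder g) (i : Fin d)
    (c : Fin d → K) (hgc : ∀ l, (g : (Fin d → K) →ₗ[K] (Fin d → K)) (b l) = c l • b l)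
    (h1 : ∀ l, l ≠ i → c l = 1) (hi : c i ≠ 1) : IsPseudoReflection g := by
  refine ⟨hg, ?_⟩
  have hE : Module.End.eigenspace (g : (Fin d → K) →ₗ[K] (Fin d → K)) 1 =
      LinearMap.ker (b.coord i) := by
    ext v
    rw [Module.End.mem_eigenspace_iff, one_smul, LinearMap.mem_ker, Module.Basis.coord_apply]
    have hv : ∀ l, b.repr ((g : (Fin d → K) →ₗ[K] (Fin d → K)) v) l = c l * b.repr v l := by
      intro l
      refine LinearMap.congr_fun (f := b.coord l ∘ₗ (g : (Fin d → K) →ₗ[K] (Fin d → K)))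
        (g := c l • b.coord l) (b.ext fun k => ?_) v
      rcases eq_or_ne k l with rfl | hkl <;> simp [*]
    constructor
    · intro h
      have := hv i
      rw [h] at this
      by_contra h0
      exact hi (mul_right_cancel₀ h0 (by rw [one_mul, ← this]))
    · intro h
      apply b.repr.injective
      ext l
      rw [hv]
      by_cases hl : l = i
      · rw [hl, h, mul_zero]
      · rw [h1 l hl, one_mul]
  have hs : Function.Surjective (b.coord i) := fun x => ⟨x • b i, by simp⟩
  have := LinearMap.finrank_range_add_finrank_ker (b.coord i)
  rw [LinearMap.range_eq_top.2 hs, finrank_top, Module.finrank_self,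
    Module.finrank_fin_fun] at this
  rw [hE]
  omega

end

/-! ### Coprime exponents give local freeness -/

section

variable {K : Type*} [Field K] {d : ℕ} {b : Module.Basis (Fin d) K (Fin d → K)}
  {G : Subgroup (LinearMap.GeneralLinearGroup K (Fin d → K))}

theorem mem_gradedMaximalIdeal_iff (f : invariants b G) :
    f ∈ gradedMaximalIdeal b G ↔ coeff 0 (f : MvPolynomial (Fin d) K) = 0 := by
  have h : ((GradedRing.proj (grading b G) 0 f : invariants b G) : MvPolynomial (Fin d) K) =
      C (coeff 0 (f : MvPolynomial (Fin d) K)) := by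
    rw [← homogeneousComponent_zero]
    exact decomposeFun_apply b G f 0
  -- The irrelevant ideal is by definition the kernel of the projection to degree zero.
  change GradedRing.proj (grading b G) 0 f = 0 ↔ _
  rw [← Subtype.coe_inj, h, ZeroMemClass.coe_zero, C_eq_zero]

variable [Finite G] {σ : LinearMap.GeneralLinearGroup K (Fin d → K)} {c : Fin d → K} {n : ℕ}

theorem monomial_nsmul_mem_invariants (hG : G = Subgroup.zpowers σ)
    (hσ : ∀ j, (σ : (Fin d → K) →ₗ[K] (Fin d → K)) (b j) = c j • b j) (hc : ∀ j, c j ^ n = 1)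
    (u : Fin d →₀ ℕ) (a : K) : monomial (n • u) a ∈ invariants b G := by
  rw [mem_invariants_iff hG hσ, act_monomial hσ]
  simp [pow_mul, hc]

theorem X_pow_mem_invariants (hG : G = Subgroup.zpowers σ)
    (hσ : ∀ j, (σ : (Fin d → K) →ₗ[K] (Fin d → K)) (b j) = c j • b j) (hc : ∀ j, c j ^ n = 1)
    (j : Fin d) : X j ^ n ∈ invariants b G := by
  rw [mem_invariants_iff hG hσ, map_pow, act_X_of_apply_eq_smul b σ j _ (hσ j), mul_pow,
    ← map_pow, hc, map_one, one_mul]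

theorem monomial_coeff_mem_invariants (hG : G = Subgroup.zpowers σ)
    (hσ : ∀ j, (σ : (Fin d → K) →ₗ[K] (Fin d → K)) (b j) = c j • b j)
    {f : MvPolynomial (Fin d) K} (hf : f ∈ invariants b G) (m : Fin d →₀ ℕ) :
    monomial m (coeff m f) ∈ invariants b G := by
  rw [mem_invariants_iff hG hσ] at hf ⊢
  rw [act_monomial hσ, C_mul_monomial, ← coeff_act hσ, hf]

/-- A prime of `R^G` containing all the powers `X_j ^ n` is the graded maximal ideal. -/
theorem eq_gradedMaximalIdeal_of_X_pow_mem (hG : G = Subgroup.zpowers σ)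
    (hσ : ∀ j, (σ : (Fin d → K) →ₗ[K] (Fin d → K)) (b j) = c j • b j) (hc : ∀ j, c j ^ n = 1)
    (p : Ideal (invariants b G)) [hp : p.IsPrime]
    (hX : ∀ j, (⟨X j ^ n, X_pow_mem_invariants hG hσ hc j⟩ : invariants b G) ∈ p) :
    p = gradedMaximalIdeal b G := by
  have hle : gradedMaximalIdeal b G ≤ p := by
    intro f hf
    rw [mem_gradedMaximalIdeal_iff] at hf
    have hsum : f = ∑ m ∈ (f : MvPolynomial (Fin d) K).support,
        (⟨monomial m (coeff m (f : MvPolynomial (Fin d) K)),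
          monomial_coeff_mem_invariants hG hσ f.2 m⟩ : invariants b G) := by
      apply Subtype.ext
      rw [AddSubmonoidClass.coe_finsetSum]
      exact as_sum _
    rw [hsum]
    refine Ideal.sum_mem _ fun m hm => hp.mem_of_pow_mem n ?_
    have hm0 : m ≠ 0 := by
      rintro rfl
      exact mem_support_iff.1 hm hf
    obtain ⟨j, hj⟩ := Finsupp.ne_iff.1 hm0
    have hmj : m = Finsupp.single j 1 + (m - Finsupp.single j 1) :=
      (add_tsub_cancel_of_le (Finsupp.single_le_iff.2 (Nat.one_le_iff_ne_zero.2 hj))).symm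
    -- The `n`-th power of the monomial is `X j ^ n` times a monomial whose exponents are again
    -- multiples of `n`, so the cofactor is invariant.
    refine Ideal.mem_of_dvd _ ⟨⟨monomial (n • (m - Finsupp.single j 1))
      (coeff m (f : MvPolynomial (Fin d) K) ^ n), monomial_nsmul_mem_invariants hG hσ hc _ _⟩,
      ?_⟩ (hX j)
    apply Subtype.ext
    simp only [SubmonoidClass.mk_pow, MulMemClass.mk_mul_mk, monomial_pow, X_pow_eq_monomial,
      monomial_mul, one_mul]
    conv_lhs => rw [hmj]
    rw [smul_add, Finsupp.smul_single, smul_eq_mul, mul_one, ← hmj]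
  refine le_antisymm (fun f hf => ?_) hle
  rw [mem_gradedMaximalIdeal_iff]
  by_contra h0
  set a := coeff 0 (f : MvPolynomial (Fin d) K) with ha
  have h1 : f - algebraMap K (invariants b G) a ∈ p := hle <| by
    rw [mem_gradedMaximalIdeal_iff, AddSubgroupClass.coe_sub, Subalgebra.coe_algebraMap,
      algebraMap_eq, coeff_sub, coeff_zero_C, ← ha, sub_self]
  -- Subtracting an element of `𝔪_G ≤ p` leaves a nonzero constant, a unit, in `p`.
  have h2 : algebraMap K (invariants b G) a ∈ p := by
    simpa using p.sub_mem hf h1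
  exact hp.ne_top (p.eq_top_of_isUnit_mem h2 ((isUnit_iff_ne_zero.2 h0).map _))

theorem isLocallyFreeOn_semiInvariants (hG : G = Subgroup.zpowers σ) {ξ : K} {t : Fin d → ℕ}
    (hn : 0 < n) (hξ : IsPrimitiveRoot ξ n)
    (hσ : ∀ j, (σ : (Fin d → K) →ₗ[K] (Fin d → K)) (b j) = ξ ^ t j • b j)
    (ht : ∀ j, Nat.gcd (t j) n = 1) (χ : G →* Kˣ) :
    IsLocallyFreeOn (invariants b G) (semiInvariants b G χ) (gradedPuncturedSpectrum b G) := by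
  rintro p ⟨-, hpm⟩
  have hc : ∀ j, (ξ ^ t j) ^ n = 1 := fun j => by rw [pow_right_comm, hξ.pow_eq_one, one_pow]
  obtain ⟨j, hj⟩ : ∃ j, (⟨X j ^ n, X_pow_mem_invariants hG hσ hc j⟩ : invariants b G) ∉
      p.asIdeal := by
    by_contra! h
    exact hpm (eq_gradedMaximalIdeal_of_X_pow_mem hG hσ hc p.asIdeal h)
  have hσn : σ ^ n = 1 := by
    apply Units.ext
    refine b.ext fun j => ?_
    rw [pow_apply_eq_smul σ _ _ (hσ j), hc]
    simp
  have hNZ : NeZero n := ⟨hn.ne'⟩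
  set w : Kˣ := χ ⟨σ, hG ▸ Subgroup.mem_zpowers σ⟩ with hw
  have hwn : (w : K) ^ n = 1 := by
    rw [← Units.val_pow_eq_pow_val, hw, ← map_pow χ,
      show (⟨σ, hG ▸ Subgroup.mem_zpowers σ⟩ : G) ^ n = 1 from Subtype.ext hσn, map_one,
      Units.val_one]
  obtain ⟨e, -, he⟩ := hξ.eq_pow_of_pow_eq_one hwn
  obtain ⟨a, ha⟩ := exists_sum_mul_modEq_one {j} t hn (by simpa using ht j)
  rw [Finset.sum_singleton] at ha
  -- As `a j` inverts `t j` modulo `n`, the power `X j ^ (a j * e)` has weight `ξ ^ e = w`.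
  have hk : (ξ ^ t j) ^ (a j * e) = w := by
    rw [← he, ← pow_mul]
    refine pow_eq_pow_of_modEq ?_ hξ.pow_eq_one
    calc t j * (a j * e) = a j * t j * e := by ring
      _ ≡ 1 * e [MOD n] := ha.mul_right e
      _ = e := one_mul e
  set k := a j * e
  have hXk : act b σ (X j ^ k) = C (w : K) * X j ^ k := by
    rw [map_pow, act_X_of_apply_eq_smul b σ j _ (hσ j), mul_pow, ← map_pow, hk]
  refine free_localizedModule_of_smul_eq p.asIdeal
    (⟨X j ^ k, (mem_semiInvariants_iff hG hσ χ _).2 hXk⟩ : semiInvariants b G χ) ?_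
    (⟨X j ^ n, X_pow_mem_invariants hG hσ hc j⟩ ^ k)
    (fun h => hj (p.isPrime.mem_of_pow_mem k h)) ?_
  · intro r hr
    have hr' : (r : MvPolynomial (Fin d) K) * X j ^ k = 0 := congrArg Subtype.val hr
    exact Subtype.ext ((mul_eq_zero.1 hr').resolve_right (pow_ne_zero _ (X_ne_zero j)))
  · rintro ⟨f, hf⟩
    rw [mem_semiInvariants_iff hG hσ] at hf
    -- The total weight is `w ^ n = 1`; this is the coefficient of `X j ^ k` in `X j ^ (n * k) * f`.
    have hinv : (X j ^ k) ^ (n - 1) * f ∈ invariants b G := by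
      rw [mem_invariants_iff hG hσ, map_mul, map_pow, hXk, hf, ← hw, mul_pow, mul_mul_mul_comm,
        ← pow_succ, Nat.sub_add_cancel hn, ← map_pow, hwn, map_one, one_mul]
    refine ⟨⟨_, hinv⟩, Subtype.ext ?_⟩
    change (X j ^ n) ^ k * f = (X j ^ k) ^ (n - 1) * f * X j ^ k
    rw [mul_right_comm, ← pow_succ, Nat.sub_add_cancel hn, pow_right_comm]

end

/-! ### Local freeness forces coprime exponents -/

section

variable {K : Type*} [Field K] {d : ℕ}

/-- The restriction of polynomials to the `j`-th coordinate axis. -/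
def axisRestriction (K : Type*) [Field K] {d : ℕ} (j : Fin d) :
    MvPolynomial (Fin d) K →ₐ[K] MvPolynomial (Fin d) K :=
  aeval fun l => if l = j then X l else 0

theorem homogeneousComponent_axisRestriction (j : Fin d) (f : MvPolynomial (Fin d) K) (m : ℕ) :
    homogeneousComponent m (axisRestriction K j f) =
      axisRestriction K j (homogeneousComponent m f) := by
  have hhom : ∀ i, (axisRestriction K j (homogeneousComponent i f)).IsHomogeneous i := by
    intro i
    have h := (homogeneousComponent_isHomogeneous i f).aeval
      (fun l => if l = j then (X l : MvPolynomial (Fin d) K) else 0) (n := 1) (fun l => by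
        split_ifs
        · exact isHomogeneous_X _ _
        · exact isHomogeneous_zero _ _ _)
    rwa [one_mul] at h
  conv_lhs => rw [← sum_homogeneousComponent f, map_sum, map_sum]
  simp_rw [homogeneousComponent_of_mem (hhom _)]
  rw [Finset.sum_ite_eq]
  split_ifs with h
  · rfl
  · rw [homogeneousComponent_eq_zero _ _ (by simpa [Nat.lt_succ_iff] using h), map_zero]

/-- The ideal of invariants vanishing on the `j`-th coordinate axis. -/
def axisIdeal (b : Module.Basis (Fin d) K (Fin d → K))
    (G : Subgroup (LinearMap.GeneralLinearGroup K (Fin d → K))) (j : Fin d) :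
    Ideal (invariants b G) :=
  (RingHom.ker (axisRestriction K j)).comap (invariants b G).val

variable {b : Module.Basis (Fin d) K (Fin d → K)}
  {G : Subgroup (LinearMap.GeneralLinearGroup K (Fin d → K))}

theorem mem_axisIdeal_iff {j : Fin d} {f : invariants b G} :
    f ∈ axisIdeal b G j ↔ axisRestriction K j (f : MvPolynomial (Fin d) K) = 0 := Iff.rfl

instance axisIdeal_isPrime (j : Fin d) : (axisIdeal b G j).IsPrime := by
  have := RingHom.ker_isPrime (axisRestriction K j)
  exact Ideal.IsPrime.comap _

theorem axisIdeal_isHomogeneous (j : Fin d) :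
    (axisIdeal b G j).IsHomogeneous (grading b G) := by
  intro i f hf
  rw [mem_axisIdeal_iff] at hf ⊢
  have h : ((DirectSum.decompose (grading b G) f i : invariants b G) : MvPolynomial (Fin d) K) =
      homogeneousComponent i (f : MvPolynomial (Fin d) K) := decomposeFun_apply b G f i
  rw [h, ← homogeneousComponent_axisRestriction, hf, map_zero]

/-- In the absence of pseudo-reflections, any `d - 1` of the exponents are jointly coprime
to `n`. -/
theorem gcd_erase_eq_one [Finite G] {σ : LinearMap.GeneralLinearGroup K (Fin d → K)}
    (hσG : σ ∈ G) {n : ℕ} (hn : 0 < n) {ξ : K} (hξ : IsPrimitiveRoot ξ n) {t : Fin d → ℕ}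
    (hσ : ∀ j, (σ : (Fin d → K) →ₗ[K] (Fin d → K)) (b j) = ξ ^ t j • b j)
    (hgcd : Nat.gcd (Finset.univ.gcd t) n = 1) (hrefl : ∀ g ∈ G, ¬ IsPseudoReflection g)
    (i : Fin d) : Nat.gcd ((Finset.univ.erase i).gcd t) n = 1 := by
  set e := Nat.gcd ((Finset.univ.erase i).gcd t) n with he
  have hen : e ∣ n := Nat.gcd_dvd_right _ _
  have hdvd : ∀ l, n ∣ t l * (n / e) → e ∣ t l := by
    intro l h
    have hpos : 0 < n / e := Nat.div_pos (Nat.le_of_dvd hn hen) (Nat.pos_of_dvd_of_pos hen hn)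
    refine Nat.dvd_of_mul_dvd_mul_right hpos ?_
    rwa [Nat.mul_div_cancel' hen]
  have ht : ∀ l, l ≠ i → e ∣ t l := fun l hl => (Nat.gcd_dvd_left _ _).trans
    (Finset.gcd_dvd (Finset.mem_erase.2 ⟨hl, Finset.mem_univ l⟩))
  by_contra hne
  have hσfin : IsOfFinOrder σ := (Submonoid.isOfFinOrder_coe (H := G.toSubmonoid)).2
    (isOfFinOrder_of_finite (⟨σ, hσG⟩ : G))
  -- Since `e ∣ t l` for `l ≠ i`, this power fixes every `b l` except possibly `b i`. If it fixed `b
  -- i` too, `e` would divide all the exponents and `n`, forcing `e = 1`.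
  refine hrefl (σ ^ (n / e)) (G.pow_mem hσG _) (isPseudoReflection_of_apply_eq b _ hσfin.pow i
    (fun l => (ξ ^ t l) ^ (n / e)) (fun l => pow_apply_eq_smul σ _ _ (hσ l) _) ?_ ?_)
  · intro l hl
    obtain ⟨r, hr⟩ := ht l hl
    rw [← pow_mul, hξ.pow_eq_one_iff_dvd, hr, mul_right_comm, Nat.mul_div_cancel' hen]
    exact dvd_mul_right _ _
  · intro h
    rw [← pow_mul, hξ.pow_eq_one_iff_dvd] at h
    have hall : e ∣ Finset.univ.gcd t := Finset.dvd_gcd fun l _ => by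
      by_cases hl : l = i
      · exact hl ▸ hdvd i h
      · exact ht l hl
    exact hne (Nat.dvd_one.1 (hgcd ▸ Nat.dvd_gcd hall hen))

/-- Sending `σ` to `ξ` is well defined: `σ ^ m = 1` gives `(ξ ^ m) ^ t l = 1` for all `l`, and
Bézout modulo `n` then yields `ξ ^ m = 1`. -/
theorem exists_monoidHom_apply_eq [Finite G] {σ : LinearMap.GeneralLinearGroup K (Fin d → K)}
    (hG : G = Subgroup.zpowers σ) {n : ℕ} (hn : 0 < n) {ξ : K} (hξ : IsPrimitiveRoot ξ n)
    {t : Fin d → ℕ} (hσ : ∀ j, (σ : (Fin d → K) →ₗ[K] (Fin d → K)) (b j) = ξ ^ t j • b j)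
    (hgcd : Nat.gcd (Finset.univ.gcd t) n = 1) :
    ∃ χ : G →* Kˣ, ((χ ⟨σ, hG ▸ Subgroup.mem_zpowers σ⟩ : Kˣ) : K) = ξ := by
  set s : G := ⟨σ, hG ▸ Subgroup.mem_zpowers σ⟩ with hs
  have hgen : ∀ x : G, x ∈ Subgroup.zpowers s := by
    intro x
    obtain ⟨k, hk⟩ := exists_nat_pow_eq hG x.2
    exact ⟨k, Subtype.ext (by simpa using hk.symm)⟩
  have hord : orderOf (hξ.isUnit hn.ne').unit ∣ orderOf s := by
    rw [orderOf_dvd_iff_pow_eq_one]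
    apply Units.ext
    rw [Units.val_pow_eq_pow_val, IsUnit.unit_spec, Units.val_one]
    have hσm : σ ^ orderOf s = 1 := congrArg Subtype.val (pow_orderOf_eq_one s)
    have hm : ∀ l, (ξ ^ orderOf s) ^ t l = 1 := by
      intro l
      have h := pow_apply_eq_smul σ _ _ (hσ l) (orderOf s)
      rw [hσm, Units.val_one, Module.End.one_apply] at h
      have h' := congrArg (fun v => b.repr v l) h
      simp only [map_smul, Module.Basis.repr_self, Finsupp.smul_apply, Finsupp.single_eq_same,
        smul_eq_mul, mul_one] at h'
      rw [pow_right_comm, ← h']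
    obtain ⟨a, ha⟩ := exists_sum_mul_modEq_one Finset.univ t hn hgcd
    calc ξ ^ orderOf s = (ξ ^ 1) ^ orderOf s := by rw [pow_one]
      _ = (ξ ^ ∑ l, a l * t l) ^ orderOf s := by
        rw [pow_eq_pow_of_modEq ha.symm hξ.pow_eq_one]
      _ = ∏ l, ((ξ ^ orderOf s) ^ t l) ^ a l := by
        rw [pow_right_comm, ← Finset.prod_pow_eq_pow_sum]
        exact Finset.prod_congr rfl fun l _ => by rw [mul_comm, pow_mul]
      _ = 1 := Finset.prod_eq_one fun l _ => by rw [hm, one_pow]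
  exact ⟨monoidHomOfForallMemZpowers hgen hord, by
    rw [monoidHomOfForallMemZpowers_apply_gen, IsUnit.unit_spec]⟩

theorem mem_of_X_dvd_prod_X_pow {ι : Type*} {S : Finset ι} {a : ι → ℕ} {i : ι} :
    (X i : MvPolynomial ι K) ∣ ∏ l ∈ S, X l ^ a l → i ∈ S := by
  intro h
  obtain ⟨l, hl, hd⟩ := (X_prime.dvd_finsetProd_iff _).1 h
  rwa [X_dvd_X.1 (X_prime.dvd_of_dvd_pow hd)]

/-- A prime dividing one of the products is associated to some `X l`, which the `l`-th product
omits. -/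
theorem exists_not_prime_dvd_prod_X_pow (a : Fin d → Fin d → ℕ) (i₀ : Fin d)
    (q : MvPolynomial (Fin d) K) (hq : Prime q) :
    ∃ i, ¬ q ∣ ∏ l ∈ Finset.univ.erase i, X l ^ a i l := by
  by_contra! h
  obtain ⟨l, -, hd⟩ := (hq.dvd_finsetProd_iff _).1 (h i₀)
  have hX := (hq.associated_of_dvd X_prime (hq.dvd_of_dvd_pow hd)).symm.dvd
  exact Finset.notMem_erase l _ (mem_of_X_dvd_prod_X_pow (hX.trans (h l)))

set_option synthInstance.maxHeartbeats 200000 in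
/-- The semi-invariants form a module of rank at most one. -/
theorem exists_smul_eq_smul_semiInvariants [Finite G]
    {σ : LinearMap.GeneralLinearGroup K (Fin d → K)}
    (hG : G = Subgroup.zpowers σ) {n : ℕ} (hn : 0 < n) {ξ : K} (hξ : IsPrimitiveRoot ξ n)
    {t : Fin d → ℕ} (hσ : ∀ j, (σ : (Fin d → K) →ₗ[K] (Fin d → K)) (b j) = ξ ^ t j • b j)
    (χ : G →* Kˣ) (hχ : ((χ ⟨σ, hG ▸ Subgroup.mem_zpowers σ⟩ : Kˣ) : K) = ξ)
    (x y : semiInvariants b G χ) (hx0 : x ≠ 0) :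
    ∃ r s : invariants b G, s ≠ 0 ∧ r • x = s • y := by
  obtain ⟨x, hx⟩ := x
  obtain ⟨y, hy⟩ := y
  rw [mem_semiInvariants_iff hG hσ, hχ] at hx hy
  have hx0' : x ≠ 0 := fun h => hx0 (Subtype.ext h)
  -- The quotient `y / x` is written as `x ^ (n - 1) * y` over `x ^ n`, both of weight `ξ ^ n = 1`.
  have hxy : x ^ (n - 1) * y ∈ invariants b G := by
    rw [mem_invariants_iff hG hσ, map_mul, map_pow, hx, hy, mul_pow, mul_mul_mul_comm,
      ← pow_succ, Nat.sub_add_cancel hn, ← map_pow, hξ.pow_eq_one, map_one, one_mul]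
  have hxn : x ^ n ∈ invariants b G := by
    rw [mem_invariants_iff hG hσ, map_pow, hx, mul_pow, ← map_pow, hξ.pow_eq_one, map_one,
      one_mul]
  refine ⟨⟨_, hxy⟩, ⟨_, hxn⟩, fun h => pow_ne_zero n hx0' (congrArg Subtype.val h),
    Subtype.ext ?_⟩
  change x ^ (n - 1) * y * x = x ^ n * y
  rw [mul_right_comm, ← pow_succ, Nat.sub_add_cancel hn]

set_option maxHeartbeats 1600000 in
set_option synthInstance.maxHeartbeats 200000 in
/-- If the semi-invariants are free at the `j`-th axis, then some semi-invariant of weight `ξ` does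
not vanish on that axis. -/
theorem exists_axisRestriction_ne_zero [Finite G]
    {σ : LinearMap.GeneralLinearGroup K (Fin d → K)}
    (hG : G = Subgroup.zpowers σ) {n : ℕ} (hn : 0 < n) {ξ : K} (hξ : IsPrimitiveRoot ξ n)
    {t : Fin d → ℕ} (hσ : ∀ j, (σ : (Fin d → K) →ₗ[K] (Fin d → K)) (b j) = ξ ^ t j • b j)
    (hgcd : Nat.gcd (Finset.univ.gcd t) n = 1) (hrefl : ∀ g ∈ G, ¬ IsPseudoReflection g)
    (hfree : ∀ χ : G →* Kˣ, IsLocallyFreeOn (invariants b G) (semiInvariants b G χ)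
      (gradedPuncturedSpectrum b G)) (j : Fin d) :
    ∃ f, act b σ f = C ξ * f ∧ axisRestriction K j f ≠ 0 := by
  have hc : ∀ j, (ξ ^ t j) ^ n = 1 := fun j => by rw [pow_right_comm, hξ.pow_eq_one, one_pow]
  have hX : ∀ l, act b σ (X l) = C (ξ ^ t l) * X l := fun l =>
    act_X_of_apply_eq_smul b σ l _ (hσ l)
  obtain ⟨χ, hχ⟩ := exists_monoidHom_apply_eq hG hn hξ hσ hgcd
  have hmem : ∀ f, f ∈ semiInvariants b G χ ↔ act b σ f = C ξ * f := fun f => by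
    rw [mem_semiInvariants_iff hG hσ, hχ]
  choose a ha using fun i => exists_sum_mul_modEq_one _ t hn
    (gcd_erase_eq_one (hG ▸ Subgroup.mem_zpowers σ) hn hξ hσ hgcd hrefl i)
  have hM : ∀ i, ∏ l ∈ Finset.univ.erase i, X l ^ a i l ∈ semiInvariants b G χ := by
    intro i
    rw [hmem, map_prod]
    simp_rw [map_pow, hX, mul_pow, Finset.prod_mul_distrib, ← map_pow, ← map_prod, ← pow_mul,
      Finset.prod_pow_eq_pow_sum, mul_comm (t _)]
    rw [pow_eq_pow_of_modEq (ha i) hξ.pow_eq_one, pow_one]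
  have hpunct : (⟨axisIdeal b G j, axisIdeal_isPrime j⟩ : PrimeSpectrum (invariants b G)) ∈
      gradedPuncturedSpectrum b G := by
    refine ⟨axisIdeal_isHomogeneous j, fun h => ?_⟩
    -- The invariant `X j ^ n` lies in `𝔪_G` but does not vanish on the `j`-th axis.
    have hin : (⟨X j ^ n, X_pow_mem_invariants hG hσ hc j⟩ : invariants b G) ∈
        axisIdeal b G j := by
      rw [show axisIdeal b G j = gradedMaximalIdeal b G from h, mem_gradedMaximalIdeal_iff]
      change coeff 0 (X j ^ n) = 0
      rw [← constantCoeff_eq, map_pow, constantCoeff_X, zero_pow hn.ne']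
    rw [mem_axisIdeal_iff] at hin
    simp [axisRestriction, X_ne_zero] at hin
  obtain ⟨⟨f, hf⟩, s, hs, hsf⟩ := exists_smul_eq_smul_of_free (axisIdeal b G j)
    (hfree χ _ hpunct) (exists_smul_eq_smul_semiInvariants hG hn hξ hσ χ hχ) (fun i => (⟨_, hM i⟩ : semiInvariants b G χ))
  have hdvd : f ∣ (s : MvPolynomial (Fin d) K) := by
    refine dvd_of_forall_dvd_mul (fun i => ∏ l ∈ Finset.univ.erase i, X l ^ a i l)
      (exists_not_prime_dvd_prod_X_pow a j) j
      (Finset.prod_ne_zero_iff.2 fun l _ => pow_ne_zero _ (X_ne_zero l)) f _ fun i => ?_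
    obtain ⟨r, hr⟩ := hsf i
    exact ⟨r, (congrArg Subtype.val hr).trans (mul_comm _ _)⟩
  refine ⟨f, (hmem f).1 hf, fun h => ?_⟩
  obtain ⟨r, hr⟩ := hdvd
  exact hs (mem_axisIdeal_iff.2 (by rw [hr, map_mul, h, zero_mul]))

theorem gcd_eq_one_of_isLocallyFreeOn [Finite G]
    {σ : LinearMap.GeneralLinearGroup K (Fin d → K)}
    (hG : G = Subgroup.zpowers σ) {n : ℕ} (hn : 0 < n) {ξ : K} (hξ : IsPrimitiveRoot ξ n)
    {t : Fin d → ℕ} (hσ : ∀ j, (σ : (Fin d → K) →ₗ[K] (Fin d → K)) (b j) = ξ ^ t j • b j)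
    (hgcd : Nat.gcd (Finset.univ.gcd t) n = 1) (hrefl : ∀ g ∈ G, ¬ IsPseudoReflection g)
    (hfree : ∀ χ : G →* Kˣ, IsLocallyFreeOn (invariants b G) (semiInvariants b G χ)
      (gradedPuncturedSpectrum b G)) (j : Fin d) : Nat.gcd (t j) n = 1 := by
  obtain ⟨f, hf, hf0⟩ := exists_axisRestriction_ne_zero hG hn hξ hσ hgcd hrefl hfree j
  set e := Nat.gcd (t j) n with he
  have hen : e ∣ n := Nat.gcd_dvd_right _ _
  -- Since `e ∣ t j`, the exponent `t j * (n / e)` is a multiple of `n`, so `σ ^ (n / e)` acts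
  -- trivially on the axis.
  have hcomp : (axisRestriction K j).comp (act b (σ ^ (n / e))) = axisRestriction K j := by
    ext1 l
    rw [AlgHom.comp_apply, act_pow_X hσ, map_mul, algHom_C, algebraMap_eq]
    by_cases hl : l = j
    · obtain ⟨r, hr⟩ : e ∣ t j := Nat.gcd_dvd_left _ _
      rw [hl, ← pow_mul, (hξ.pow_eq_one_iff_dvd _).2, map_one, one_mul]
      rw [hr, mul_right_comm, Nat.mul_div_cancel' hen]
      exact dvd_mul_right _ _
    · simp [axisRestriction, hl]
  have hfix := AlgHom.congr_fun hcomp f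
  rw [AlgHom.comp_apply, act_pow_eigen hσ hf, map_mul, algHom_C, algebraMap_eq] at hfix
  have h1 : ξ ^ (n / e) = 1 := by
    apply C_injective (Fin d) K
    rw [map_one]
    exact mul_right_cancel₀ hf0 (by rw [hfix, one_mul])
  have h2 : n ∣ n / e := (hξ.pow_eq_one_iff_dvd _).1 h1
  have hpos : 0 < n / e := Nat.div_pos (Nat.le_of_dvd hn hen) (Nat.pos_of_dvd_of_pos hen hn)
  have h3 := Nat.le_of_dvd hpos h2
  by_contra hne
  have he0 : 0 < e := Nat.pos_of_dvd_of_pos hen hn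
  exact absurd h3 (not_le.2 (Nat.div_lt_self hn (by omega)))

end

end SemiInv

end

theorem corollary3p14 {K : Type*} [Field K] [IsAlgClosed K] {d : ℕ} (hd : 2 ≤ d)
    (G : Subgroup (LinearMap.GeneralLinearGroup K (Fin d → K))) [Finite G]
    (hcard : (Nat.card G : K) ≠ 0)
    (σ : LinearMap.GeneralLinearGroup K (Fin d → K)) (hG : G = Subgroup.zpowers σ)
    (b : Module.Basis (Fin d) K (Fin d → K))
    (n : ℕ) (hn : 0 < n) (ξ : K) (hξ : IsPrimitiveRoot ξ n) (t : Fin d → ℕ)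
    (hσ : ∀ j, (σ : (Fin d → K) →ₗ[K] (Fin d → K)) (b j) = ξ ^ t j • b j)
    (hgcd : Nat.gcd (Finset.univ.gcd t) n = 1)
    (hrefl : ∀ g ∈ G, ¬ SemiInv.IsPseudoReflection g) :
    (∀ χ : G →* Kˣ, SemiInv.IsLocallyFreeOn (SemiInv.invariants b G) (SemiInv.semiInvariants b G χ)
        (SemiInv.gradedPuncturedSpectrum b G)) ↔
      ∀ j, Nat.gcd (t j) n = 1 :=
  ⟨SemiInv.gcd_eq_one_of_isLocallyFreeOn hG hn hξ hσ hgcd hrefl,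
    fun ht χ => SemiInv.isLocallyFreeOn_semiInvariants hG hn hξ hσ ht χ⟩
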